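/- Let $n\ge 1$, $T>0$, $\sigma>0$, $P\ge 0$, and let $A,B,C$ be real $n\times n$ matrices. Put $$\mathcal O=\int_0^T e^{A^\top t}C^\top C e^{At}\,dt,\qquad \mathcal W(\Sigma)=\sum_{k=0}^{\infty}e^{AkT}B\Sigma B^\top e^{A^\top kT},$$ $$f(\Sigma)=\frac12\log_2\frac{\det(\sigma^2I+\mathcal O\,\mathcal W(\Sigma))}{\det(\sigma^2I+\mathcal O(\mathcal W(\Sigma)-B\Sigma B^\top))},$$ and let the information rate of the network $(A,B,C)$ with window $T$, noise variance $\sigma^2$ and power $P$ be $$\mathcal R_T=\frac1T\max\{f(\Sigma):\ \Sigma\in\mathbb R^{n\times n},\ \Sigma\succcurlyeq 0,\ \operatorname{tr}\Sigma\le P\}.$$ Suppose that $B=C=I$ and that $A$ is normal ($AA^\top=A^\top A$) and stable (all its complex eigenvalues have negative real part), and let $\lambda_1,\dots,\lambda_n\in\mathbb C$ be its eigenvalues, listed with algebraic multiplicity. Then the maximum defining $\mathcal R_T$ is attained; every maximizing covariance $\Sigma$ is diagonal in the eigenbasis of $A$, that is, $U\Sigma U^\dagger$ is diagonal for every unitary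 $U\in\mathbb C^{n\times n}$ for which $UAU^\dagger$ is diagonal; and $$\mathcal R_T=\max_{\substack{P_1,\dots,P_n\ge 0\\ P_1+\dots+P_n=P}}\ \sum_{i=1}^n\mathcal R_T(P_i,\lambda_i),\qquad \mathcal R_T(P,\lambda)=\frac1{2T}\log_2\frac{\frac{P}{\sigma^2}-2\,\mathrm{Re}\,\lambda}{\frac{P}{\sigma^2}e^{2T\,\mathrm{Re}\,\lambda}-2\,\mathrm{Re}\,\lambda},$$ where the maximum on the right is attained. -/

import Mathlib

noncomputable section

namespace InfoRate

/-- Observability Gramian `∫₀ᵀ e^{Aᵀt} Cᵀ C e^{At} dt` of the pair `(A, C)` over `[0, T]`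
(the integral of the matrix-valued function is taken entry by entry). -/
def obsGramian {n p : ℕ} (A : Matrix (Fin n) (Fin n) ℝ) (C : Matrix (Fin p) (Fin n) ℝ) (T : ℝ) :
    Matrix (Fin n) (Fin n) ℝ :=
  Matrix.of fun i j =>
    ∫ t in (0 : ℝ)..T,
      (NormedSpace.exp (t • A.transpose) * (C.transpose * C) * NormedSpace.exp (t • A)) i j

/-- Infinite-horizon controllability Gramian `∑_{k ≥ 0} e^{AkT} B Σ Bᵀ e^{AᵀkT}` of the
discretized pair `(e^{AT}, B Σ^{1/2})`. -/
def ctrlGramian {n m : ℕ} (A : Matrix (Fin n) (Fin n) ℝ) (B : Matrix (Fin n) (Fin m) ℝ) (T : ℝ)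
    (S : Matrix (Fin m) (Fin m) ℝ) : Matrix (Fin n) (Fin n) ℝ :=
  ∑' k : ℕ, NormedSpace.exp (((k : ℝ) * T) • A) * (B * S * B.transpose) *
    NormedSpace.exp (((k : ℝ) * T) • A.transpose)

/-- The mutual information (in bits) between one input symbol with covariance `Σ` and the
corrupted output over a window of length `T`:
`(1/2) log₂ (det (σ² I + O W) / det (σ² I + O (W - B Σ Bᵀ)))`. -/
def info {n m p : ℕ} (A : Matrix (Fin n) (Fin n) ℝ) (B : Matrix (Fin n) (Fin m) ℝ)
    (C : Matrix (Fin p) (Fin n) ℝ) (T σ : ℝ) (S : Matrix (Fin m) (Fin m) ℝ) : ℝ :=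
  1 / 2 * Real.logb 2
    ((σ ^ 2 • (1 : Matrix (Fin n) (Fin n) ℝ) + obsGramian A C T * ctrlGramian A B T S).det /
      (σ ^ 2 • (1 : Matrix (Fin n) (Fin n) ℝ) +
        obsGramian A C T * (ctrlGramian A B T S - B * S * B.transpose)).det)

/-- Input covariances of power at most `P`. -/
def admissible (m : ℕ) (P : ℝ) : Set (Matrix (Fin m) (Fin m) ℝ) :=
  {S | S.PosSemidef ∧ S.trace ≤ P}

/-- Information capacity `C_T`: the largest value of `info` over the admissible covariances. -/
def capacity {n m p : ℕ} (A : Matrix (Fin n) (Fin n) ℝ) (B : Matrix (Fin n) (Fin m) ℝ)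
    (C : Matrix (Fin p) (Fin n) ℝ) (T σ P : ℝ) : ℝ :=
  sSup (info A B C T σ '' admissible m P)

/-- Information rate `R_T = C_T / T`. -/
def rate {n m p : ℕ} (A : Matrix (Fin n) (Fin n) ℝ) (B : Matrix (Fin n) (Fin m) ℝ)
    (C : Matrix (Fin p) (Fin n) ℝ) (T σ P : ℝ) : ℝ :=
  capacity A B C T σ P / T

/-- A real matrix seen as a complex one. -/
def toComplex {n : ℕ} (A : Matrix (Fin n) (Fin n) ℝ) : Matrix (Fin n) (Fin n) ℂ :=
  A.map (algebraMap ℝ ℂ)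

/-- Hurwitz stability: every complex eigenvalue has negative real part. -/
def IsStable {n : ℕ} (A : Matrix (Fin n) (Fin n) ℝ) : Prop :=
  ∀ μ ∈ spectrum ℂ (toComplex A), μ.re < 0

/-- `l` lists the complex eigenvalues of `A` with algebraic multiplicity. -/
def IsEigenvalueList {n : ℕ} (A : Matrix (Fin n) (Fin n) ℝ) (l : Fin n → ℂ) : Prop :=
  (toComplex A).charpoly = ∏ i, (Polynomial.X - Polynomial.C (l i))

/-- The scalar rate `R_T(P, l)`. -/
def scalarRate (T σ P : ℝ) (l : ℂ) : ℝ :=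
  1 / (2 * T) * Real.logb 2
    ((P / σ ^ 2 - 2 * l.re) / (P / σ ^ 2 * Real.exp (2 * T * l.re) - 2 * l.re))

/-- Allocations of the total power `P` to `n` modes. -/
def allocations (n : ℕ) (P : ℝ) : Set (Fin n → ℝ) :=
  {p | (∀ i, 0 ≤ p i) ∧ ∑ i, p i = P}

end InfoRate

end

/-! In an orthonormal eigenbasis of `A` the observability Gramian is a positive diagonal matrix and
the controllability Gramian `W` of an input covariance `S` solves the Stein equation
`W - E W Eᴴ = S`, where `E` is the diagonal matrix of the multipliers `e^{T λᵢ}`. Dividing the noise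
by the modal gains, the determinant ratio in the mutual information becomes
`det X / det (E X Eᴴ + N)` for the positive definite matrix `X` of noise plus `W` and a positive
diagonal matrix `N`. Adding a positive diagonal matrix to a positive definite one multiplies its
determinant by at least the factor by which it multiplies the product of the diagonal entries:
entry by entry this is `1 / Xᵢᵢ ≤ (X⁻¹)ᵢᵢ`, which is strict when column `i` has a nonzero
off-diagonal entry. So the mutual information is at most that of independent modes which receive the
powers on the diagonal of `S`, with equality only for diagonal `S`.

Conversely, the total rate of independent modes is strictly concave and symmetric under exchanging
modes of equal decay rate `Re λᵢ`, so the optimal allocation gives such modes the same power. It is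
therefore a polynomial in the eigenvalues `2 Re λᵢ` of `A + Aᵀ`, and the same polynomial in `A + Aᵀ`
is a real covariance which attains it. -/

noncomputable section

namespace InfoRate

open Matrix
open scoped ComplexOrder

section DetAddDiagonal

variable {ι 𝕜 : Type*} [RCLike 𝕜] {X : Matrix ι ι 𝕜}

lemma prod_diag_add_pos [Fintype ι] (hX : X.PosDef) {N : ι → 𝕜} (hN : ∀ i, 0 ≤ N i) :
    0 < ∏ i, (X i i + N i) :=
  Finset.prod_pos fun i _ => add_pos_of_pos_of_nonneg hX.diag_pos (hN i)

lemma prod_mul_star_pos [Fintype ι] {e : ι → 𝕜} (he : ∀ i, e i ≠ 0) : 0 < ∏ i, e i * star (e i) :=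
  Finset.prod_pos fun i _ => mul_star_self_pos (.of_ne_zero (he i))

variable [DecidableEq ι]

lemma posDef_add_sum_diagonal_single (hX : X.PosDef) {N : ι → 𝕜} (hN : ∀ i, 0 ≤ N i)
    (s : Finset ι) : (X + ∑ i ∈ s, diagonal (Pi.single i (N i))).PosDef :=
  hX.add_posSemidef <| posSemidef_sum s fun i _ =>
    PosSemidef.diagonal (Pi.single_nonneg.mpr (hN i))

lemma add_sum_diagonal_single_apply_of_notMem (N : ι → 𝕜) {s : Finset ι} {j : ι} (hj : j ∉ s)
    (i : ι) : (X + ∑ k ∈ s, diagonal (Pi.single k (N k))) i j = X i j := by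
  rw [Matrix.add_apply, Matrix.sum_apply, Finset.sum_eq_zero, add_zero]
  intro k hk
  rcases eq_or_ne i j with rfl | hij
  · have hik : i ≠ k := fun h => hj (h ▸ hk)
    rw [diagonal_apply_eq, Pi.single_eq_of_ne hik]
  · exact diagonal_apply_ne _ hij

variable [Fintype ι]

lemma det_add_diagonal_single (hX : IsUnit X.det) (i : ι) (c : 𝕜) :
    (X + diagonal (Pi.single i c)).det = X.det * (1 + c * X⁻¹ i i) := by
  have hrank_one : diagonal (Pi.single i c) =
      replicateCol Unit (Pi.single i c) * replicateRow Unit (Pi.single i (1 : 𝕜)) := by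
    ext a b
    by_cases ha : a = i <;> by_cases hb : b = i <;>
      simp [Matrix.mul_apply, diagonal_apply, ha, hb, eq_comm (a := i)]
  rw [hrank_one, det_add_replicateCol_mul_replicateRow hX]
  simp [Matrix.mul_apply, Pi.single_apply, mul_comm]

lemma mulVec_inv_col (hX : IsUnit X.det) (i : ι) : X *ᵥ X⁻¹.col i = Pi.single i 1 := by
  rw [← mulVec_single_one, mulVec_mulVec, mul_nonsing_inv _ hX, one_mulVec]

lemma quadraticForm_inv_col_sub_single (hX : X.PosDef) (i : ι) :
    star (X⁻¹.col i - Pi.single i (X i i)⁻¹) ⬝ᵥ X *ᵥ (X⁻¹.col i - Pi.single i (X i i)⁻¹) =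
      X⁻¹ i i - (X i i)⁻¹ := by
  have hunit : IsUnit X.det := X.isUnit_iff_isUnit_det.mp hX.isUnit
  have hrow : star (X⁻¹.col i) = X⁻¹.row i := funext fun j => hX.inv.isHermitian.apply i j
  have hdiag : star (X i i) = X i i := hX.isHermitian.apply i i
  have hinv : X⁻¹.row i ⬝ᵥ X.col i = 1 := by
    simpa [mul_apply, dotProduct] using congrFun₂ (nonsing_inv_mul X hunit) i i
  have hne : X i i ≠ 0 := hX.diag_pos.ne'
  have hsingle : (Pi.single i (X i i)⁻¹ : ι → 𝕜) = (X i i)⁻¹ • Pi.single i 1 := by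
    rw [← Pi.single_smul, smul_eq_mul, mul_one]
  rw [hsingle, mulVec_sub, mulVec_smul, mulVec_inv_col hunit, mulVec_single_one, star_sub,
    star_smul, hrow, star_inv₀, hdiag, sub_dotProduct, dotProduct_sub, dotProduct_sub,
    smul_dotProduct, smul_dotProduct, dotProduct_smul, dotProduct_smul, hinv]
  simp [hne]

lemma inv_diag_le_diag_inv (hX : X.PosDef) (i : ι) : (X i i)⁻¹ ≤ X⁻¹ i i := by
  rw [← sub_nonneg, ← quadraticForm_inv_col_sub_single hX]
  exact hX.posSemidef.dotProduct_mulVec_nonneg _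

lemma inv_diag_lt_diag_inv (hX : X.PosDef) {i j : ι} (hij : i ≠ j) (h : X i j ≠ 0) :
    (X j j)⁻¹ < X⁻¹ j j := by
  rw [← sub_pos, ← quadraticForm_inv_col_sub_single hX]
  refine hX.dotProduct_mulVec_pos fun hzero => h ?_
  have hunit : IsUnit X.det := X.isUnit_iff_isUnit_det.mp hX.isUnit
  have := congrFun (mulVec_inv_col hunit j) i
  rw [sub_eq_zero.mp hzero] at this
  simpa [hij, hX.diag_pos.ne'] using this

lemma det_mul_diag_add_le (hX : X.PosDef) (i : ι) {c : 𝕜} (hc : 0 ≤ c) :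
    X.det * (X i i + c) ≤ (X + diagonal (Pi.single i c)).det * X i i := by
  have hpos : 0 < X i i := hX.diag_pos
  calc X.det * (X i i + c) = X.det * (1 + c * (X i i)⁻¹) * X i i := by
        field_simp
    _ ≤ X.det * (1 + c * X⁻¹ i i) * X i i := by
        gcongr
        · exact hX.det_pos.le
        · exact inv_diag_le_diag_inv hX i
    _ = _ := by rw [det_add_diagonal_single (X.isUnit_iff_isUnit_det.mp hX.isUnit)]

lemma det_mul_diag_add_lt (hX : X.PosDef) {i j : ι} (hij : i ≠ j) (h : X i j ≠ 0) {c : 𝕜}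
    (hc : 0 < c) : X.det * (X j j + c) < (X + diagonal (Pi.single j c)).det * X j j := by
  have hpos : 0 < X j j := hX.diag_pos
  calc X.det * (X j j + c) = X.det * (1 + c * (X j j)⁻¹) * X j j := by
        field_simp
    _ < X.det * (1 + c * X⁻¹ j j) * X j j := by
        gcongr
        · exact hX.det_pos
        · exact inv_diag_lt_diag_inv hX hij h
    _ = _ := by rw [det_add_diagonal_single (X.isUnit_iff_isUnit_det.mp hX.isUnit)]

lemma det_mul_prod_diag_add_le (hX : X.PosDef) {N : ι → 𝕜} (hN : ∀ i, 0 ≤ N i)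
    (s : Finset ι) :
    X.det * ∏ i ∈ s, (X i i + N i) ≤
      (X + ∑ i ∈ s, diagonal (Pi.single i (N i))).det * ∏ i ∈ s, X i i := by
  induction s using Finset.induction_on with
  | empty => simp
  | insert i s hi ih =>
    set Z := X + ∑ j ∈ s, diagonal (Pi.single j (N j))
    have hZ : Z.PosDef := posDef_add_sum_diagonal_single hX hN s
    have hZi : Z i i = X i i := add_sum_diagonal_single_apply_of_notMem N hi i
    have hstep := det_mul_diag_add_le hZ i (hN i)
    rw [hZi] at hstep
    rw [Finset.prod_insert hi, Finset.prod_insert hi, Finset.sum_insert hi, add_comm (diagonal _),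
      ← add_assoc]
    calc X.det * ((X i i + N i) * ∏ j ∈ s, (X j j + N j))
        = (X.det * ∏ j ∈ s, (X j j + N j)) * (X i i + N i) := by ring
      _ ≤ (Z.det * ∏ j ∈ s, X j j) * (X i i + N i) := by
        refine mul_le_mul_of_nonneg_right ih ?_
        exact add_nonneg hX.diag_pos.le (hN i)
      _ = Z.det * (X i i + N i) * ∏ j ∈ s, X j j := by ring
      _ ≤ (Z + diagonal (Pi.single i (N i))).det * X i i * ∏ j ∈ s, X j j := by
        gcongr
        exact Finset.prod_nonneg fun j _ => hX.diag_pos.le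
      _ = _ := by ring

lemma add_sum_univ_diagonal_single (X : Matrix ι ι 𝕜) (N : ι → 𝕜) :
    X + ∑ i, diagonal (Pi.single i (N i)) = X + diagonal N := by
  rw [← Finset.univ_sum_single N, ← diagonalAddMonoidHom_apply, map_sum]
  simp

theorem det_mul_prod_diag_add_lt (hX : X.PosDef) (hoff : ¬ X.IsDiag) {N : ι → 𝕜}
    (hN : ∀ i, 0 < N i) : X.det * ∏ i, (X i i + N i) < (X + diagonal N).det * ∏ i, X i i := by
  obtain ⟨j, i, hji, hne⟩ : ∃ j i, j ≠ i ∧ X j i ≠ 0 := by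
    simpa [IsDiag, Pairwise] using hoff
  set s := Finset.univ.erase i
  have his : i ∉ s := Finset.notMem_erase i _
  have hN' : ∀ i, 0 ≤ N i := fun i => (hN i).le
  set Z := X + ∑ k ∈ s, diagonal (Pi.single k (N k))
  have hZ : Z.PosDef := posDef_add_sum_diagonal_single hX hN' s
  have hZi (k : ι) : Z k i = X k i := add_sum_diagonal_single_apply_of_notMem N his k
  have hstep := det_mul_diag_add_lt hZ hji (by rwa [hZi]) (hN i)
  rw [hZi] at hstep
  have hlast : X + diagonal N = Z + diagonal (Pi.single i (N i)) := by
    rw [← add_sum_univ_diagonal_single, ← Finset.sum_erase_add _ _ (Finset.mem_univ i),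
      ← add_assoc]
  rw [← Finset.prod_erase_mul _ _ (Finset.mem_univ i),
    ← Finset.prod_erase_mul _ _ (Finset.mem_univ i), hlast]
  calc X.det * ((∏ k ∈ s, (X k k + N k)) * (X i i + N i))
      = (X.det * ∏ k ∈ s, (X k k + N k)) * (X i i + N i) := by ring
    _ ≤ (Z.det * ∏ k ∈ s, X k k) * (X i i + N i) := by
      refine mul_le_mul_of_nonneg_right (det_mul_prod_diag_add_le hX hN' s) ?_
      exact add_nonneg hX.diag_pos.le (hN' i)
    _ = Z.det * (X i i + N i) * ∏ k ∈ s, X k k := by ring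
    _ < (Z + diagonal (Pi.single i (N i))).det * X i i * ∏ k ∈ s, X k k := by
      gcongr
      exact Finset.prod_pos fun k _ => hX.diag_pos
    _ = _ := by ring

lemma det_add_diagonal_pos (hX : X.PosDef) {N : ι → 𝕜} (hN : ∀ i, 0 ≤ N i) :
    0 < (X + diagonal N).det :=
  (hX.add_posSemidef (PosSemidef.diagonal hN)).det_pos

theorem det_div_det_add_diagonal_lt (hX : X.PosDef) (hoff : ¬ X.IsDiag) {N : ι → 𝕜}
    (hN : ∀ i, 0 < N i) : X.det / (X + diagonal N).det < ∏ i, X i i / (X i i + N i) := by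
  have hN' : ∀ i, 0 ≤ N i := fun i => (hN i).le
  rw [Finset.prod_div_distrib,
    div_lt_div_iff₀ (det_add_diagonal_pos hX hN') (prod_diag_add_pos hX hN'),
    mul_comm (∏ i, X i i)]
  exact det_mul_prod_diag_add_lt hX hoff hN

lemma posDef_diagonal_conj {e : ι → 𝕜} (he : ∀ i, e i ≠ 0) (hX : X.PosDef) :
    (diagonal e * X * (diagonal e)ᴴ).PosDef := by
  have hunit : IsUnit (diagonal e) := by
    simpa [isUnit_diagonal, Pi.isUnit_iff, isUnit_iff_ne_zero] using he
  exact (IsUnit.posDef_star_right_conjugate_iff hunit).mpr hX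

lemma diagonal_conj_apply (e : ι → 𝕜) (X : Matrix ι ι 𝕜) (i j : ι) :
    (diagonal e * X * (diagonal e)ᴴ) i j = e i * star (e j) * X i j := by
  rw [diagonal_conjTranspose, mul_diagonal, diagonal_mul, Pi.star_apply]
  ring

lemma det_diagonal_conj (e : ι → 𝕜) (X : Matrix ι ι 𝕜) :
    (diagonal e * X * (diagonal e)ᴴ).det = (∏ i, e i * star (e i)) * X.det := by
  rw [det_mul, det_mul, det_diagonal, diagonal_conjTranspose, det_diagonal,
    Finset.prod_mul_distrib]
  simp only [Pi.star_apply]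
  ring

lemma isDiag_of_isDiag_diagonal_conj {e : ι → 𝕜} (he : ∀ i, e i ≠ 0)
    (h : (diagonal e * X * (diagonal e)ᴴ).IsDiag) : X.IsDiag := fun i j hij => by
  simpa [diagonal_conj_apply, he] using h hij

theorem det_div_det_diagonal_conj_add_lt (hX : X.PosDef) (hoff : ¬ X.IsDiag) {e N : ι → 𝕜}
    (he : ∀ i, e i ≠ 0) (hN : ∀ i, 0 < N i) :
    X.det / (diagonal e * X * (diagonal e)ᴴ + diagonal N).det <
      ∏ i, X i i / (e i * star (e i) * X i i + N i) := by
  have h := det_div_det_add_diagonal_lt (posDef_diagonal_conj he hX)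
    (fun hdiag => hoff (isDiag_of_isDiag_diagonal_conj he hdiag)) hN
  simp only [det_diagonal_conj, diagonal_conj_apply, mul_div_assoc,
    Finset.prod_mul_distrib (f := fun i => e i * star (e i))] at h
  exact lt_of_mul_lt_mul_left h (prod_mul_star_pos he).le

end DetAddDiagonal

section SteinSum

variable {ι : Type*} {e : ι → ℂ}

/-- The sum `∑ₖ Eᵏ S (Eᵏ)ᴴ` for `E = diagonal e` with `‖e i‖ < 1`, in closed form: each entry is a
geometric series. It is the controllability Gramian in modal coordinates and solves the Stein
equation `W - E W Eᴴ = S`. -/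
def steinSum (e : ι → ℂ) (S : Matrix ι ι ℂ) : Matrix ι ι ℂ :=
  Matrix.of fun i j => S i j / (1 - e i * star (e j))

lemma norm_mul_star_lt_one (he : ∀ i, ‖e i‖ < 1) (i j : ι) : ‖e i * star (e j)‖ < 1 := by
  rw [norm_mul, norm_star]
  exact mul_lt_one_of_nonneg_of_lt_one_left (norm_nonneg _) (he i) (he j).le

lemma one_sub_mul_star_ne_zero (he : ∀ i, ‖e i‖ < 1) (i j : ι) : 1 - e i * star (e j) ≠ 0 := by
  intro h
  have hlt := norm_mul_star_lt_one he i j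
  rw [← sub_eq_zero.mp h, norm_one] at hlt
  exact lt_irrefl _ hlt

lemma isDiag_steinSum_iff (he : ∀ i, ‖e i‖ < 1) {S : Matrix ι ι ℂ} :
    (steinSum e S).IsDiag ↔ S.IsDiag := by
  simp only [IsDiag, steinSum, of_apply, div_eq_zero_iff, one_sub_mul_star_ne_zero he, or_false]

lemma hasSum_steinSum [Fintype ι] [DecidableEq ι] (he : ∀ i, ‖e i‖ < 1)
    (S : Matrix ι ι ℂ) :
    HasSum (fun k : ℕ => diagonal (e ^ k) * S * (diagonal (e ^ k))ᴴ) (steinSum e S) := by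
  refine Pi.hasSum.mpr fun i => Pi.hasSum.mpr fun j => ?_
  have hgeom := (hasSum_geometric_of_norm_lt_one (norm_mul_star_lt_one he i j)).mul_left (S i j)
  rw [← div_eq_mul_inv] at hgeom
  refine hgeom.congr_fun fun k => ?_
  simp only [diagonal_conjTranspose, mul_diagonal, diagonal_mul, Pi.star_apply, Pi.pow_apply,
    mul_pow, star_pow]
  ring

lemma steinSum_sub [Fintype ι] [DecidableEq ι] (he : ∀ i, ‖e i‖ < 1) (S : Matrix ι ι ℂ) :
    steinSum e S - S = diagonal e * steinSum e S * (diagonal e)ᴴ := by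
  ext i j
  have hne := one_sub_mul_star_ne_zero he i j
  simp only [diagonal_conjTranspose, mul_diagonal, diagonal_mul, Matrix.sub_apply, steinSum,
    of_apply, Pi.star_apply]
  field_simp
  ring

open scoped MatrixOrder Matrix.Norms.L2Operator in
lemma posSemidef_of_hasSum [Finite ι] {κ : Type*} {f : κ → Matrix ι ι ℂ} {W : Matrix ι ι ℂ}
    (hf : ∀ k, (f k).PosSemidef) (h : HasSum f W) : W.PosSemidef := by
  classical
  have := Fintype.ofFinite ι
  exact nonneg_iff_posSemidef.mp (h.nonneg fun k => (hf k).nonneg)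

lemma posSemidef_steinSum [Finite ι] (he : ∀ i, ‖e i‖ < 1) {S : Matrix ι ι ℂ}
    (hS : S.PosSemidef) : (steinSum e S).PosSemidef := by
  classical
  have := Fintype.ofFinite ι
  exact posSemidef_of_hasSum (fun _ => hS.mul_mul_conjTranspose_same _) (hasSum_steinSum he S)

lemma posSemidef_steinSum_sub [Finite ι] (he : ∀ i, ‖e i‖ < 1) {S : Matrix ι ι ℂ}
    (hS : S.PosSemidef) : (steinSum e S - S).PosSemidef := by
  classical
  have := Fintype.ofFinite ι
  rw [steinSum_sub he]
  exact (posSemidef_steinSum he hS).mul_mul_conjTranspose_same _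

variable [Fintype ι] [DecidableEq ι]

lemma det_eq_prod_diag_of_isDiag {M : Matrix ι ι ℂ} (hM : M.IsDiag) : M.det = ∏ i, M i i := by
  rw [← hM.diagonal_diag, det_diagonal]
  simp

lemma diagonal_add_steinSum_sub (he : ∀ i, ‖e i‖ < 1) (b : ι → ℂ) (S : Matrix ι ι ℂ) :
    diagonal b + (steinSum e S - S) =
      diagonal e * (diagonal b + steinSum e S) * (diagonal e)ᴴ +
        diagonal fun i => b i * (1 - e i * star (e i)) := by
  rw [mul_add, add_mul, ← steinSum_sub he, diagonal_conjTranspose, diagonal_mul_diagonal,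
    diagonal_mul_diagonal, add_right_comm, diagonal_add]
  congr 2
  ext i
  simp only [Pi.star_apply]
  ring

variable {b : ι → ℂ} {S : Matrix ι ι ℂ}

theorem det_div_det_steinSum_lt (hb : ∀ i, 0 < b i) (he : ∀ i, ‖e i‖ < 1) (he0 : ∀ i, e i ≠ 0)
    (hS : S.PosSemidef) (hoff : ¬ S.IsDiag) :
    (diagonal b + steinSum e S).det / (diagonal b + (steinSum e S - S)).det <
      ∏ i, (diagonal b + steinSum e S) i i / (diagonal b + (steinSum e S - S)) i i := by
  have hoff' : ¬ (diagonal b + steinSum e S).IsDiag := fun h =>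
    hoff <| (isDiag_steinSum_iff he).mp <| by simpa using h.sub (isDiag_diagonal b)
  have hpos (i : ι) : 0 < b i * (1 - e i * star (e i)) := by
    refine mul_pos (hb i) (sub_pos.mpr ?_)
    rw [Complex.star_def, Complex.mul_conj']
    exact_mod_cast pow_lt_one₀ (norm_nonneg _) (he i) two_ne_zero
  have hY := (PosDef.diagonal hb).add_posSemidef (posSemidef_steinSum he hS)
  rw [diagonal_add_steinSum_sub he]
  simpa only [Matrix.add_apply, diagonal_conj_apply, diagonal_apply_eq] using
    det_div_det_diagonal_conj_add_lt hY hoff' he0 hpos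

theorem det_div_det_steinSum_of_isDiag (b : ι → ℂ) (he : ∀ i, ‖e i‖ < 1) (hS : S.IsDiag) :
    (diagonal b + steinSum e S).det / (diagonal b + (steinSum e S - S)).det =
      ∏ i, (diagonal b + steinSum e S) i i / (diagonal b + (steinSum e S - S)) i i := by
  have hW := (isDiag_steinSum_iff he).mpr hS
  rw [det_eq_prod_diag_of_isDiag ((isDiag_diagonal b).add hW),
    det_eq_prod_diag_of_isDiag ((isDiag_diagonal b).add (hW.sub hS)), Finset.prod_div_distrib]

end SteinSum

section NormalMatrix

open Module.End in
lemma exists_orthonormalBasis_eigenvectors_of_commute {ι 𝕜 E : Type*} [Fintype ι] [RCLike 𝕜]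
    [NormedAddCommGroup E] [InnerProductSpace 𝕜 E] [FiniteDimensional 𝕜 E]
    (hι : Fintype.card ι = Module.finrank 𝕜 E) {F G : E →ₗ[𝕜] E} (hF : F.IsSymmetric)
    (hG : G.IsSymmetric) (hFG : Commute F G) :
    ∃ (b : OrthonormalBasis ι 𝕜 E) (x y : ι → 𝕜),
      ∀ a, F (b a) = x a • b a ∧ G (b a) = y a • b a := by
  classical
  have hinternal := LinearMap.IsSymmetric.directSum_isInternal_of_commute hF hG hFG
  have horth := LinearMap.IsSymmetric.orthogonalFamily_eigenspace_inf_eigenspace hF hG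
  let _ : Fintype {i : 𝕜 × 𝕜 // eigenspace F i.2 ⊓ eigenspace G i.1 ≠ ⊥} :=
    (WellFoundedGT.finite_ne_bot_of_iSupIndep hinternal.submodule_iSupIndep).fintype
  have hinternal' := DirectSum.isInternal_ne_bot_iff.mpr hinternal
  have horth' := horth.comp (Subtype.val_injective
    (p := fun i : 𝕜 × 𝕜 => eigenspace F i.2 ⊓ eigenspace G i.1 ≠ ⊥))
  have hb a := hinternal'.subordinateOrthonormalBasis_subordinate rfl a horth'
  let b := hinternal'.subordinateOrthonormalBasis rfl horth'
  let eigenvalues a := (hinternal'.subordinateOrthonormalBasisIndex rfl a horth').1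
  let φ := Fintype.equivFinOfCardEq hι
  refine ⟨b.reindex φ.symm, fun a => (eigenvalues (φ a)).2, fun a => (eigenvalues (φ a)).1,
    fun a => ?_⟩
  rw [b.reindex_apply, Equiv.symm_symm]
  exact ⟨mem_eigenspace_iff.mp (hb (φ a)).1, mem_eigenspace_iff.mp (hb (φ a)).2⟩

variable {ι : Type*} [Fintype ι] [DecidableEq ι] {M : Matrix ι ι ℂ}

open scoped ComplexStarModule in
lemma exists_orthonormalBasis_eigenvectors_of_isStarNormal (hM : IsStarNormal M) :
    ∃ (b : OrthonormalBasis ι ℂ (EuclideanSpace ℂ ι)) (d : ι → ℂ),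
      ∀ a, M.toEuclideanLin (b a) = d a • b a := by
  have hsymm (H : selfAdjoint (Matrix ι ι ℂ)) : H.1.toEuclideanLin.IsSymmetric :=
    isSymmetric_toEuclideanLin_iff.mpr H.2
  have hcomm : Commute (toEuclideanLin (ℜ M).1) (toEuclideanLin (ℑ M).1) :=
    (isStarNormal_iff_commute_realPart_imaginaryPart.mp hM).map (toLpLinAlgEquiv 2)
  obtain ⟨b, x, y, hb⟩ := exists_orthonormalBasis_eigenvectors_of_commute
    (finrank_euclideanSpace (𝕜 := ℂ) (ι := ι)).symm (hsymm (ℜ M)) (hsymm (ℑ M)) hcomm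
  refine ⟨b, fun a => x a + Complex.I * y a, fun a => ?_⟩
  conv_lhs => rw [← realPart_add_I_smul_imaginaryPart M]
  rw [map_add, map_smul, LinearMap.add_apply, LinearMap.smul_apply, (hb a).1, (hb a).2, smul_smul,
    add_smul]

theorem exists_unitary_conj_eq_diagonal (hM : IsStarNormal M) :
    ∃ U : unitaryGroup ι ℂ, ∃ d : ι → ℂ, U.1 * M * star U.1 = diagonal d := by
  obtain ⟨b, d, hb⟩ := exists_orthonormalBasis_eigenvectors_of_isStarNormal hM
  let V : unitaryGroup ι ℂ := ⟨(EuclideanSpace.basisFun ι ℂ).toBasis.toMatrix b,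
    (EuclideanSpace.basisFun ι ℂ).toMatrix_orthonormalBasis_mem_unitary b⟩
  have hV (i a : ι) : V.1 i a = b a i := by simp [V, Module.Basis.toMatrix_apply]
  have hMV : M * V.1 = V.1 * diagonal d := by
    ext i a
    have := congrFun (congrArg WithLp.ofLp (hb a)) i
    rw [mul_diagonal, hV, mul_comm]
    simpa [mul_apply, hV, mulVec, dotProduct, toLpLin_apply] using this
  refine ⟨star V, d, ?_⟩
  rw [Unitary.coe_star, star_star, mul_assoc, hMV, ← mul_assoc, Unitary.coe_star_mul_self, one_mul]

end NormalMatrix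

section Coordinates

variable {n : ℕ}

/-- The real matrix `M` in the coordinates of the orthonormal basis of `ℂⁿ` given by `U`, that is,
`U M U†`, as a homomorphism of real `⋆`-algebras; the star of a real matrix is its transpose. -/
def coords (U : unitaryGroup (Fin n) ℂ) :
    Matrix (Fin n) (Fin n) ℝ →⋆ₐ[ℝ] Matrix (Fin n) (Fin n) ℂ :=
  (Unitary.conjStarAlgAut ℝ (Matrix (Fin n) (Fin n) ℂ) U).toStarAlgHom.comp
    { (Algebra.ofId ℝ ℂ).mapMatrix with
      map_star' := fun M => by ext i j; simp }

variable (U : unitaryGroup (Fin n) ℂ) (M : Matrix (Fin n) (Fin n) ℝ)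

lemma coords_apply : coords U M = U.1 * toComplex M * (U.1)ᴴ := rfl

lemma coords_injective : Function.Injective (coords U) := by
  refine (Unitary.conjStarAlgAut ℝ _ U).injective.comp ?_
  exact Matrix.map_injective (algebraMap ℝ ℂ).injective

lemma continuous_coords : Continuous (coords U) :=
  ((coords U).toAlgHom.toLinearMap).continuous_of_finiteDimensional

lemma coords_transpose : coords U Mᵀ = (coords U M)ᴴ := by
  rw [← conjTranspose_eq_transpose_of_trivial]
  exact map_star (coords U) M

lemma det_coords : (coords U M).det = M.det := by
  rw [coords_apply, det_mul_right_comm, ← star_eq_conjTranspose,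
    Unitary.mul_star_self_of_mem U.2, one_mul]
  exact ((algebraMap ℝ ℂ).map_det M).symm

lemma trace_coords : (coords U M).trace = M.trace := by
  rw [coords_apply, trace_mul_cycle, ← star_eq_conjTranspose,
    Unitary.star_mul_self_of_mem U.2, one_mul]
  simp [toComplex, trace]

lemma charpoly_coords : (coords U M).charpoly = (toComplex M).charpoly := by
  rw [coords_apply, charpoly_mul_comm, ← mul_assoc, ← star_eq_conjTranspose,
    Unitary.star_mul_self_of_mem U.2, one_mul]

variable {M} in
open scoped MatrixOrder Matrix.Norms.L2Operator in
lemma posSemidef_coords (hM : M.PosSemidef) : (coords U M).PosSemidef := by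
  obtain ⟨B, rfl⟩ := CStarAlgebra.nonneg_iff_eq_star_mul_self.mp hM.nonneg
  rw [map_mul, map_star]
  exact posSemidef_conjTranspose_mul_self _

variable {U M} in
lemma posSemidef_of_posSemidef_coords (h : (coords U M).PosSemidef) : M.PosSemidef := by
  have hherm : M.IsHermitian := coords_injective U <| by
    rw [conjTranspose_eq_transpose_of_trivial, coords_transpose, h.isHermitian.eq]
  have hC : (toComplex M).PosSemidef :=
    (IsUnit.posSemidef_star_right_conjugate_iff (Unitary.toUnits U).isUnit).mp h
  refine .of_dotProduct_mulVec_nonneg hherm fun x => ?_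
  have hquad : star (fun i => (x i : ℂ)) ⬝ᵥ toComplex M *ᵥ (fun i => (x i : ℂ)) =
      ((star x ⬝ᵥ M *ᵥ x : ℝ) : ℂ) := by
    simp [dotProduct, mulVec, toComplex]
  exact Complex.zero_le_real.mp (hquad ▸ hC.dotProduct_mulVec_nonneg _)

lemma coords_exp : coords U (NormedSpace.exp M) = NormedSpace.exp (coords U M) :=
  open scoped Matrix.Norms.Operator in
  NormedSpace.map_exp (coords U) (continuous_coords U) M

end Coordinates

section Gramians

variable {n : ℕ} {U : unitaryGroup (Fin n) ℂ}

variable (U) in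
open scoped Matrix.Norms.Operator in
lemma coords_of_intervalIntegral {F : ℝ → Matrix (Fin n) (Fin n) ℝ} (hF : Continuous F) (a b : ℝ)
    (i j : Fin n) :
    coords U (of fun i j => ∫ t in a..b, F t i j) i j = ∫ t in a..b, coords U (F t) i j := by
  have hint := hF.intervalIntegrable (μ := MeasureTheory.volume) a b
  have hentry : (of fun i j => ∫ t in a..b, F t i j) = ∫ t in a..b, F t := by
    ext i j
    exact (entryLinearMap ℝ ℝ i j).toContinuousLinearMap.intervalIntegral_comp_comm hint
  rw [hentry]
  exact (((entryLinearMap ℝ ℂ i j).comp (coords U).toAlgHom.toLinearMap).toContinuousLinearMap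
    |>.intervalIntegral_comp_comm hint).symm

lemma coords_tsum {κ : Type*} {f : κ → Matrix (Fin n) (Fin n) ℝ} {W : Matrix (Fin n) (Fin n) ℂ}
    (h : HasSum (fun k => coords U (f k)) W) : coords U (∑' k, f k) = W := by
  obtain ⟨g, hg⟩ := (coords U).toAlgHom.toLinearMap.exists_leftInverse_of_injective
    (LinearMap.ker_eq_bot.mpr (coords_injective U))
  have hf : Summable f := by
    refine (h.summable.map g g.continuous_of_finiteDimensional).congr fun k => ?_
    exact LinearMap.congr_fun hg (f k)
  exact (hf.hasSum.map (coords U) (continuous_coords U)).unique h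

variable {A : Matrix (Fin n) (Fin n) ℝ} {d : Fin n → ℂ}

lemma coords_exp_smul (hA : coords U A = diagonal d) (t : ℝ) :
    coords U (NormedSpace.exp (t • A)) = diagonal fun i => Complex.exp (t * d i) := by
  rw [coords_exp, map_smul, hA, ← diagonal_smul, exp_diagonal, Pi.exp_def]
  simp only [Pi.smul_apply, Complex.real_smul, Complex.exp_eq_exp_ℂ]

lemma coords_exp_smul_transpose (hA : coords U A = diagonal d) (t : ℝ) :
    coords U (NormedSpace.exp (t • Aᵀ)) = (diagonal fun i => Complex.exp (t * d i))ᴴ := by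
  rw [← transpose_smul, exp_transpose, coords_transpose, coords_exp_smul hA]

/-- The gain `∫₀ᵀ |e^{zt}|² dt` with which the output window observes the mode of eigenvalue `z`. -/
def modalGain (T : ℝ) (z : ℂ) : ℝ :=
  ∫ t in (0 : ℝ)..T, Real.exp (2 * z.re * t)

lemma modalGain_eq {z : ℂ} (hz : z.re < 0) (T : ℝ) :
    modalGain T z = (1 - Real.exp (2 * T * z.re)) / (-2 * z.re) := by
  have hz' : 2 * z.re ≠ 0 := by linarith
  rw [modalGain, intervalIntegral.integral_comp_mul_left Real.exp hz', integral_exp, mul_zero,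
    Real.exp_zero, smul_eq_mul, mul_right_comm]
  field_simp
  ring

theorem coords_obsGramian_one (hA : coords U A = diagonal d) (T : ℝ) :
    coords U (obsGramian (p := n) A 1 T) =
      diagonal fun i => (modalGain T (d i) : ℂ) := by
  have hcont : Continuous fun t : ℝ => NormedSpace.exp (t • Aᵀ) *
      ((1 : Matrix (Fin n) (Fin n) ℝ)ᵀ * 1) * NormedSpace.exp (t • A) := by
    open scoped Matrix.Norms.Operator in
    have := NormedSpace.exp_continuous (𝔸 := Matrix (Fin n) (Fin n) ℝ)
    fun_prop
  have hcoords (t : ℝ) : coords U (NormedSpace.exp (t • Aᵀ) *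
      ((1 : Matrix (Fin n) (Fin n) ℝ)ᵀ * 1) * NormedSpace.exp (t • A)) =
      diagonal fun i => (Real.exp (2 * (d i).re * t) : ℂ) := by
    rw [transpose_one, one_mul, mul_one, map_mul, coords_exp_smul hA, coords_exp_smul_transpose hA,
      diagonal_conjTranspose, diagonal_mul_diagonal]
    congr 1
    ext i
    rw [Pi.star_apply, Complex.star_def, mul_comm, Complex.mul_conj', Complex.norm_exp,
      Complex.re_ofReal_mul, ← Complex.ofReal_pow, ← Real.exp_nat_mul]
    push_cast
    ring_nf
  ext i j
  rw [obsGramian, coords_of_intervalIntegral U hcont]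
  simp only [hcoords]
  rcases eq_or_ne i j with rfl | hij
  · simp only [diagonal_apply_eq, modalGain, intervalIntegral.integral_ofReal]
  · simp only [diagonal_apply_ne _ hij, intervalIntegral.integral_zero]

/-- The multipliers `e^{T d i}` of the modes over one sampling period. -/
def multiplier (T : ℝ) (d : Fin n → ℂ) (i : Fin n) : ℂ :=
  Complex.exp (T * d i)

lemma norm_multiplier (T : ℝ) (d : Fin n → ℂ) (i : Fin n) :
    ‖multiplier T d i‖ = Real.exp (T * (d i).re) := by
  rw [multiplier, Complex.norm_exp, Complex.re_ofReal_mul]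

lemma norm_multiplier_lt_one (hd : ∀ i, (d i).re < 0) {T : ℝ} (hT : 0 < T) (i : Fin n) :
    ‖multiplier T d i‖ < 1 := by
  rw [norm_multiplier, Real.exp_lt_one_iff]
  exact mul_neg_of_pos_of_neg hT (hd i)

theorem coords_ctrlGramian_one (hA : coords U A = diagonal d) (hd : ∀ i, (d i).re < 0) {T : ℝ}
    (hT : 0 < T) (S : Matrix (Fin n) (Fin n) ℝ) :
    coords U (ctrlGramian A 1 T S) =
      steinSum (multiplier T d) (coords U S) := by
  refine coords_tsum ((hasSum_steinSum (norm_multiplier_lt_one hd hT) _).congr_fun fun k => ?_)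
  have hpow : (fun i => Complex.exp (((k * T : ℝ) : ℂ) * d i)) = multiplier T d ^ k := by
    ext i
    rw [Pi.pow_apply, multiplier, ← Complex.exp_nat_mul]
    push_cast
    ring_nf
  rw [transpose_one, one_mul, mul_one, map_mul, map_mul, coords_exp_smul hA,
    coords_exp_smul_transpose hA, hpow]

end Gramians

section Allocations

variable {ι : Type*} [Fintype ι]

lemma strictConcaveOn_sum_apply {s : Set ℝ} {f : ι → ℝ → ℝ}
    (hf : ∀ i, StrictConcaveOn ℝ s (f i)) :
    StrictConcaveOn ℝ (Set.univ.pi fun _ : ι => s) fun p => ∑ i, f i (p i) := by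
  refine ⟨convex_pi fun i _ => (hf i).1, fun x hx y hy hxy a b ha hb hab => ?_⟩
  obtain ⟨i, hi⟩ := Function.ne_iff.mp hxy
  simp only [Finset.smul_sum, ← Finset.sum_add_distrib]
  exact Finset.sum_lt_sum
    (fun j _ => (hf j).concaveOn.2 (hx j trivial) (hy j trivial) ha.le hb.le hab)
    ⟨i, Finset.mem_univ i, (hf i).2 (hx i trivial) (hy i trivial) hi ha hb hab⟩

variable {n : ℕ} {P : ℝ}

lemma allocations_subset_pi_Ici : allocations n P ⊆ Set.univ.pi fun _ => Set.Ici 0 :=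
  fun _ hp i _ => hp.1 i

lemma isCompact_allocations : IsCompact (allocations n P) := by
  have hbox : IsCompact (Set.univ.pi fun _ : Fin n => Set.Icc 0 P) :=
    isCompact_univ_pi fun _ => isCompact_Icc
  refine hbox.of_isClosed_subset ?_ ?_
  · rw [allocations, Set.ofPred_and, Set.ofPred_forall]
    exact (isClosed_iInter fun i => isClosed_le continuous_const (continuous_apply i)).inter
      (isClosed_eq (by fun_prop) continuous_const)
  · rintro p ⟨h0, hs⟩ i _
    exact ⟨h0 i, hs ▸ Finset.single_le_sum (fun j _ => h0 j) (Finset.mem_univ i)⟩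

lemma convex_allocations : Convex ℝ (allocations n P) := by
  rintro p ⟨hp0, hp⟩ q ⟨hq0, hq⟩ a b ha hb hab
  refine ⟨fun i => add_nonneg (mul_nonneg ha (hp0 i)) (mul_nonneg hb (hq0 i)), ?_⟩
  simp only [Pi.add_apply, Pi.smul_apply, smul_eq_mul, Finset.sum_add_distrib, ← Finset.mul_sum]
  rw [hp, hq, ← add_mul, hab, one_mul]

lemma exists_mem_allocations_ge (hn : 0 < n) {s : Fin n → ℝ} (hs : ∀ i, 0 ≤ s i)
    (hsP : ∑ i, s i ≤ P) : ∃ p ∈ allocations n P, s ≤ p := by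
  have hrest : 0 ≤ Pi.single (M := fun _ => ℝ) (⟨0, hn⟩ : Fin n) (P - ∑ i, s i) :=
    Pi.single_nonneg.mpr (sub_nonneg.mpr hsP)
  refine ⟨s + Pi.single ⟨0, hn⟩ (P - ∑ i, s i), ⟨fun i => add_nonneg (hs i) (hrest i), ?_⟩,
    le_add_of_nonneg_right hrest⟩
  simp [Finset.sum_add_distrib]

lemma comp_perm_mem_allocations {p : Fin n → ℝ} (hp : p ∈ allocations n P)
    (π : Equiv.Perm (Fin n)) : p ∘ π ∈ allocations n P :=
  ⟨fun i => hp.1 (π i), (Equiv.sum_comp π p).trans hp.2⟩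

end Allocations

section ScalarRate

variable {T σ p : ℝ} {z : ℂ}

/-- The ratio whose logarithm is the scalar rate: signal plus noise over noise for a mode of
eigenvalue `z` which receives the power `p`. -/
def modalRatio (T σ p : ℝ) (z : ℂ) : ℝ :=
  (p / σ ^ 2 - 2 * z.re) / (p / σ ^ 2 * Real.exp (2 * T * z.re) - 2 * z.re)

lemma modalRatio_num_pos (hp : 0 ≤ p) (hz : z.re < 0) : 0 < p / σ ^ 2 - 2 * z.re := by
  have := div_nonneg hp (sq_nonneg σ)
  linarith

lemma modalRatio_den_pos (hp : 0 ≤ p) (hz : z.re < 0) :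
    0 < p / σ ^ 2 * Real.exp (2 * T * z.re) - 2 * z.re := by
  have : 0 ≤ p / σ ^ 2 * Real.exp (2 * T * z.re) := by positivity
  linarith

lemma modalRatio_pos (hp : 0 ≤ p) (hz : z.re < 0) : 0 < modalRatio T σ p z :=
  div_pos (modalRatio_num_pos hp hz) (modalRatio_den_pos hp hz)

lemma exp_two_mul_re_lt_one (hT : 0 < T) (hz : z.re < 0) : Real.exp (2 * T * z.re) < 1 :=
  Real.exp_lt_one_iff.mpr (mul_neg_of_pos_of_neg (by positivity) hz)

lemma hasDerivAt_scalarRate (hT : T ≠ 0) (hσ : σ ≠ 0) (hp : 0 ≤ p) (hz : z.re < 0) :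
    HasDerivAt (fun p => scalarRate T σ p z)
      (-z.re * (1 - Real.exp (2 * T * z.re)) / (T * Real.log 2 * σ ^ 2) /
        ((p / σ ^ 2 - 2 * z.re) * (p / σ ^ 2 * Real.exp (2 * T * z.re) - 2 * z.re))) p := by
  have hnum := (modalRatio_num_pos (σ := σ) hp hz).ne'
  have hden := (modalRatio_den_pos (T := T) (σ := σ) hp hz).ne'
  have hlin := (hasDerivAt_id p).div_const (σ ^ 2)
  have hratio := (hlin.sub_const (2 * z.re)).div
    ((hlin.mul_const (Real.exp (2 * T * z.re))).sub_const (2 * z.re)) hden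
  have hlog := ((hratio.log (div_ne_zero hnum hden)).div_const (Real.log 2)).const_mul (1 / (2 * T))
  refine hlog.congr_deriv ?_
  have hlog2 := (Real.log_pos one_lt_two).ne'
  simp only [id, Pi.div_apply] at hnum hden ⊢
  field_simp
  ring

lemma continuousOn_scalarRate (hT : T ≠ 0) (hσ : σ ≠ 0) (hz : z.re < 0) :
    ContinuousOn (fun p => scalarRate T σ p z) (Set.Ici 0) :=
  fun _ hp => (hasDerivAt_scalarRate hT hσ hp hz).continuousAt.continuousWithinAt

lemma scalarRate_deriv_num_pos (hT : 0 < T) (hσ : σ ≠ 0) (hz : z.re < 0) :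
    0 < -z.re * (1 - Real.exp (2 * T * z.re)) / (T * Real.log 2 * σ ^ 2) := by
  have hexp := sub_pos.mpr (exp_two_mul_re_lt_one hT hz)
  have := Real.log_pos one_lt_two
  have hz' := neg_pos.mpr hz
  positivity

lemma monotoneOn_scalarRate (hT : 0 < T) (hσ : σ ≠ 0) (hz : z.re < 0) :
    MonotoneOn (fun p => scalarRate T σ p z) (Set.Ici 0) := by
  refine monotoneOn_of_hasDerivWithinAt_nonneg (convex_Ici 0)
    (continuousOn_scalarRate hT.ne' hσ hz)
    (fun p hp => (hasDerivAt_scalarRate hT.ne' hσ (interior_subset hp) hz).hasDerivWithinAt)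
    fun p hp => ?_
  exact (div_pos (scalarRate_deriv_num_pos hT hσ hz)
    (mul_pos (modalRatio_num_pos (interior_subset hp) hz)
      (modalRatio_den_pos (interior_subset hp) hz))).le

lemma strictConcaveOn_scalarRate (hT : 0 < T) (hσ : σ ≠ 0) (hz : z.re < 0) :
    StrictConcaveOn ℝ (Set.Ici 0) fun p => scalarRate T σ p z := by
  refine StrictAntiOn.strictConcaveOn_of_deriv (convex_Ici 0)
    (continuousOn_scalarRate hT.ne' hσ hz) fun x hx y hy hxy => ?_
  have hx0 : (0 : ℝ) ≤ x := interior_subset hx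
  have hy0 : (0 : ℝ) ≤ y := interior_subset hy
  have : 0 < σ ^ 2 := by positivity
  rw [(hasDerivAt_scalarRate hT.ne' hσ hx0 hz).deriv,
    (hasDerivAt_scalarRate hT.ne' hσ hy0 hz).deriv]
  refine div_lt_div_of_pos_left (scalarRate_deriv_num_pos hT hσ hz)
    (mul_pos (modalRatio_num_pos hx0 hz) (modalRatio_den_pos hx0 hz)) ?_
  have hnum := modalRatio_num_pos (σ := σ) hx0 hz
  have hden := modalRatio_den_pos (T := T) (σ := σ) hx0 hz
  gcongr

end ScalarRate

section TotalRate

variable {n : ℕ} {T σ P : ℝ} {d : Fin n → ℂ}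

/-- The information rate of independent modes with eigenvalues `d` under the power allocation
`p`. -/
def totalRate (T σ : ℝ) (d : Fin n → ℂ) (p : Fin n → ℝ) : ℝ :=
  ∑ i, scalarRate T σ (p i) (d i)

lemma totalRate_comp_perm (d : Fin n → ℂ) (p : Fin n → ℝ) (π : Equiv.Perm (Fin n)) :
    totalRate T σ (d ∘ π) (p ∘ π) = totalRate T σ d p :=
  Equiv.sum_comp π fun i => scalarRate T σ (p i) (d i)

lemma totalRate_congr_re {d' : Fin n → ℂ} (h : ∀ i, (d i).re = (d' i).re) (p : Fin n → ℝ) :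
    totalRate T σ d p = totalRate T σ d' p := by
  simp only [totalRate, scalarRate, h]

lemma image_totalRate_comp_perm (d : Fin n → ℂ) (π : Equiv.Perm (Fin n)) :
    totalRate T σ (d ∘ π) '' allocations n P = totalRate T σ d '' allocations n P := by
  ext r
  constructor
  · rintro ⟨p, hp, rfl⟩
    refine ⟨p ∘ π.symm, comp_perm_mem_allocations hp _, ?_⟩
    rw [← totalRate_comp_perm _ _ π, Function.comp_assoc, Equiv.symm_comp_self, Function.comp_id]
  · rintro ⟨p, hp, rfl⟩
    exact ⟨p ∘ π, comp_perm_mem_allocations hp π, totalRate_comp_perm d p π⟩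

lemma totalRate_mono (hT : 0 < T) (hσ : σ ≠ 0) (hd : ∀ i, (d i).re < 0) {p q : Fin n → ℝ}
    (hp : 0 ≤ p) (hpq : p ≤ q) : totalRate T σ d p ≤ totalRate T σ d q :=
  Finset.sum_le_sum fun i _ =>
    monotoneOn_scalarRate hT hσ (hd i) (hp i) ((hp i).trans (hpq i)) (hpq i)

lemma strictConcaveOn_totalRate (hT : 0 < T) (hσ : σ ≠ 0) (hd : ∀ i, (d i).re < 0) :
    StrictConcaveOn ℝ (allocations n P) (totalRate T σ d) :=
  (strictConcaveOn_sum_apply fun i => strictConcaveOn_scalarRate hT hσ (hd i)).subset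
    allocations_subset_pi_Ici convex_allocations

lemma exists_isGreatest_totalRate (hn : 0 < n) (hT : T ≠ 0) (hσ : σ ≠ 0) (hP : 0 ≤ P)
    (hd : ∀ i, (d i).re < 0) : ∃ R, IsGreatest (totalRate T σ d '' allocations n P) R := by
  have hcont : ContinuousOn (totalRate T σ d) (allocations n P) :=
    continuousOn_finsetSum _ fun i _ => (continuousOn_scalarRate hT hσ (hd i)).comp
      (continuous_apply i).continuousOn fun p hp => hp.1 i
  obtain ⟨p, hp, -⟩ := exists_mem_allocations_ge hn (s := 0) (fun _ => le_rfl) (by simpa using hP)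
  exact (isCompact_allocations.image_of_continuousOn hcont).exists_isGreatest ⟨_, p, hp, rfl⟩

lemma eq_of_isMaxOn_totalRate_of_re_eq (hT : 0 < T) (hσ : σ ≠ 0) (hd : ∀ i, (d i).re < 0)
    {p : Fin n → ℝ} (hp : p ∈ allocations n P)
    (hmax : IsMaxOn (totalRate T σ d) (allocations n P) p) {i j : Fin n}
    (hij : (d i).re = (d j).re) : p i = p j := by
  have hre (k : Fin n) : (d k).re = (d (Equiv.swap i j k)).re := by
    rw [Equiv.swap_apply_def]
    split_ifs with hi hj
    · rw [hi, hij]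
    · rw [hj, hij]
    · rfl
  have hswap : totalRate T σ d (p ∘ Equiv.swap i j) = totalRate T σ d p :=
    (totalRate_congr_re hre _).trans (totalRate_comp_perm d p (Equiv.swap i j))
  have hp' := comp_perm_mem_allocations hp (Equiv.swap i j)
  have heq := (strictConcaveOn_totalRate hT hσ hd).eq_of_isMaxOn
    hmax (fun q hq => hswap ▸ hmax hq) hp hp'
  simpa using congrFun heq i

end TotalRate

section ModalInfo

variable {n : ℕ} {U : unitaryGroup (Fin n) ℂ} {A : Matrix (Fin n) (Fin n) ℝ} {d : Fin n → ℂ}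
  {T σ : ℝ}

lemma modalGain_pos {z : ℂ} (hz : z.re < 0) (hT : 0 < T) : 0 < modalGain T z := by
  rw [modalGain_eq hz]
  exact div_pos (sub_pos.mpr (exp_two_mul_re_lt_one hT hz)) (by linarith)

/-- The variance of the output noise referred to the input of the mode of eigenvalue `z`. -/
def modalNoise (T σ : ℝ) (z : ℂ) : ℝ :=
  σ ^ 2 / modalGain T z

lemma modalNoise_pos {z : ℂ} (hz : z.re < 0) (hT : 0 < T) (hσ : σ ≠ 0) : 0 < modalNoise T σ z :=
  div_pos (by positivity) (modalGain_pos hz hT)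

lemma coords_smul_one_add_obsGramian_mul (hA : coords U A = diagonal d) (hd : ∀ i, (d i).re < 0)
    (hT : 0 < T) (M : Matrix (Fin n) (Fin n) ℝ) :
    coords U (σ ^ 2 • 1 + obsGramian (p := n) A 1 T * M) =
      (diagonal fun i => (modalGain T (d i) : ℂ)) *
        ((diagonal fun i => (modalNoise T σ (d i) : ℂ)) + coords U M) := by
  have hone : coords U (σ ^ 2 • 1) =
      diagonal fun i => (modalGain T (d i) * modalNoise T σ (d i) : ℂ) := by
    rw [map_smul, map_one, ← diagonal_one, ← diagonal_smul]
    congr 1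
    ext i
    rw [Pi.smul_apply, Complex.real_smul, mul_one, ← Complex.ofReal_mul, modalNoise,
      mul_div_cancel₀ _ (modalGain_pos (hd i) hT).ne']
  rw [map_add, map_mul, coords_obsGramian_one hA, hone, mul_add, diagonal_mul_diagonal]

lemma modalRatio_eq {z : ℂ} (hz : z.re < 0) (hT : 0 < T) (hσ : σ ≠ 0) (p : ℝ) :
    modalRatio T σ p z =
      (modalNoise T σ z + p / (1 - Real.exp (2 * T * z.re))) /
        (modalNoise T σ z + (p / (1 - Real.exp (2 * T * z.re)) - p)) := by
  have hexp := sub_pos.mpr (exp_two_mul_re_lt_one hT hz)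
  rw [modalRatio, modalNoise, modalGain_eq hz,
    ← mul_div_mul_left _ _ (div_pos (pow_pos (abs_pos.mpr hσ) 2) hexp).ne', sq_abs]
  congr 1 <;> field_simp <;> ring

lemma diag_div_diag_steinSum (hd : ∀ i, (d i).re < 0) (hT : 0 < T) (hσ : σ ≠ 0)
    {X : Matrix (Fin n) (Fin n) ℂ} (hX : X.IsHermitian) (i : Fin n) :
    ((diagonal fun i => (modalNoise T σ (d i) : ℂ)) + steinSum (multiplier T d) X) i i /
        ((diagonal fun i => (modalNoise T σ (d i) : ℂ)) +
          (steinSum (multiplier T d) X - X)) i i =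
      (modalRatio T σ (X i i).re (d i) : ℂ) := by
  have hreal : X i i = ((X i i).re : ℂ) := (hX.coe_re_apply_self i).symm
  have hmult : multiplier T d i * star (multiplier T d i) =
      (Real.exp (2 * T * (d i).re) : ℂ) := by
    rw [Complex.star_def, Complex.mul_conj', norm_multiplier, ← Complex.ofReal_pow,
      ← Real.exp_nat_mul]
    push_cast
    ring_nf
  simp only [Matrix.add_apply, Matrix.sub_apply, diagonal_apply_eq, steinSum, of_apply, hmult]
  rw [hreal, modalRatio_eq (hd i) hT hσ, Complex.ofReal_re]
  push_cast
  rfl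

end ModalInfo

section ModalBound

variable {n : ℕ} {U : unitaryGroup (Fin n) ℂ} {A S : Matrix (Fin n) (Fin n) ℝ} {d : Fin n → ℂ}
  {T σ P : ℝ}

/-- The powers which the covariance `S` gives to the modes, that is, its diagonal in modal
coordinates. -/
def modalPower (U : unitaryGroup (Fin n) ℂ) (S : Matrix (Fin n) (Fin n) ℝ) (i : Fin n) : ℝ :=
  (coords U S i i).re

lemma modalPower_nonneg (U : unitaryGroup (Fin n) ℂ) (hS : S.PosSemidef) : 0 ≤ modalPower U S :=
  fun _ => (Complex.le_def.mp (posSemidef_coords U hS).diag_nonneg).1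

lemma sum_modalPower (U : unitaryGroup (Fin n) ℂ) (S : Matrix (Fin n) (Fin n) ℝ) :
    ∑ i, modalPower U S i = S.trace := by
  simpa [trace, modalPower] using congrArg Complex.re (trace_coords U S)

lemma info_one_one_eq (hA : coords U A = diagonal d) (hd : ∀ i, (d i).re < 0) (hT : 0 < T) :
    info (p := n) A 1 1 T σ S = 1 / 2 * Real.logb 2
      (((diagonal fun i => (modalNoise T σ (d i) : ℂ)) +
          steinSum (multiplier T d) (coords U S)).det /
        ((diagonal fun i => (modalNoise T σ (d i) : ℂ)) +
          (steinSum (multiplier T d) (coords U S) - coords U S)).det).re := by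
  have hgain : ∏ i, (modalGain T (d i) : ℂ) ≠ 0 := Finset.prod_ne_zero_iff.mpr fun i _ =>
    Complex.ofReal_ne_zero.mpr (modalGain_pos (hd i) hT).ne'
  rw [info, transpose_one, one_mul, mul_one, ← coords_ctrlGramian_one hA hd hT, ← map_sub]
  congr 2
  refine (Complex.ofReal_re _).symm.trans (congrArg Complex.re ?_)
  rw [Complex.ofReal_div, ← det_coords U, ← det_coords U,
    coords_smul_one_add_obsGramian_mul hA hd hT, coords_smul_one_add_obsGramian_mul hA hd hT,
    det_mul, det_mul, det_diagonal, mul_div_mul_left _ _ hgain]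

lemma mul_totalRate_eq (hd : ∀ i, (d i).re < 0) (hT : T ≠ 0) {p : Fin n → ℝ} (hp : 0 ≤ p) :
    T * totalRate T σ d p = 1 / 2 * Real.logb 2 (∏ i, modalRatio T σ (p i) (d i)) := by
  rw [Real.logb_prod _ _ fun i _ => (modalRatio_pos (hp i) (hd i)).ne', totalRate, Finset.mul_sum,
    Finset.mul_sum]
  refine Finset.sum_congr rfl fun i _ => ?_
  rw [scalarRate, modalRatio]
  field_simp

theorem info_eq_of_isDiag_coords (hA : coords U A = diagonal d) (hd : ∀ i, (d i).re < 0)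
    (hT : 0 < T) (hσ : σ ≠ 0) (hS : S.PosSemidef) (hdiag : (coords U S).IsDiag) :
    info (p := n) A 1 1 T σ S = T * totalRate T σ d (modalPower U S) := by
  rw [info_one_one_eq hA hd hT, mul_totalRate_eq hd hT.ne' (modalPower_nonneg U hS),
    det_div_det_steinSum_of_isDiag _ (norm_multiplier_lt_one hd hT) hdiag]
  simp only [diag_div_diag_steinSum hd hT hσ (posSemidef_coords U hS).isHermitian,
    ← Complex.ofReal_prod, Complex.ofReal_re, modalPower]

theorem info_lt_of_not_isDiag_coords (hA : coords U A = diagonal d) (hd : ∀ i, (d i).re < 0)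
    (hT : 0 < T) (hσ : σ ≠ 0) (hS : S.PosSemidef) (hoff : ¬ (coords U S).IsDiag) :
    info (p := n) A 1 1 T σ S < T * totalRate T σ d (modalPower U S) := by
  have hnoise (i : Fin n) : 0 < (modalNoise T σ (d i) : ℂ) :=
    Complex.zero_lt_real.mpr (modalNoise_pos (hd i) hT hσ)
  have he := norm_multiplier_lt_one hd hT
  have hX := posSemidef_coords U hS
  have hpos := div_pos
    ((PosDef.diagonal hnoise).add_posSemidef (posSemidef_steinSum he hX)).det_pos
    ((PosDef.diagonal hnoise).add_posSemidef (posSemidef_steinSum_sub he hX)).det_pos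
  have hlt := det_div_det_steinSum_lt hnoise he (fun i => Complex.exp_ne_zero _) hX hoff
  simp only [diag_div_diag_steinSum hd hT hσ hX.isHermitian, ← Complex.ofReal_prod] at hlt
  rw [info_one_one_eq hA hd hT, mul_totalRate_eq hd hT.ne' (modalPower_nonneg U hS)]
  gcongr
  · norm_num
  · exact (Complex.lt_def.mp hpos).1
  · exact (Complex.lt_def.mp hlt).1

lemma totalRate_modalPower_le (hn : 0 < n) (hd : ∀ i, (d i).re < 0) (hT : 0 < T) (hσ : σ ≠ 0)
    (hS : S ∈ admissible n P) {R : ℝ} (hR : R ∈ upperBounds (totalRate T σ d '' allocations n P)) :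
    totalRate T σ d (modalPower U S) ≤ R := by
  have hpow := modalPower_nonneg U hS.1
  obtain ⟨p, hp, hle⟩ := exists_mem_allocations_ge hn hpow ((sum_modalPower U S).trans_le hS.2)
  exact (totalRate_mono hT hσ hd hpow hle).trans (hR ⟨p, hp, rfl⟩)

end ModalBound

section EigenvalueLists

lemma exists_perm_comp_eq_of_map_univ_eq {ι α : Type*} [Fintype ι] {f g : ι → α}
    (h : Finset.univ.val.map f = Finset.univ.val.map g) : ∃ π : Equiv.Perm ι, g ∘ π = f := by
  classical
  have hcard (a : α) : Fintype.card {i // f i = a} = Fintype.card {i // g i = a} := by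
    have hcount := congrArg (Multiset.count a) h
    rw [Multiset.count_map, Multiset.count_map] at hcount
    rw [Fintype.card_subtype, Fintype.card_subtype]
    simpa only [Finset.card, Finset.filter_val, eq_comm] using hcount
  exact ⟨Equiv.ofFiberEquiv fun a => Fintype.equivOfCardEq (hcard a),
    funext fun i => Equiv.ofFiberEquiv_map _ i⟩

variable {n : ℕ} {A : Matrix (Fin n) (Fin n) ℝ} {l l' : Fin n → ℂ} {T σ P : ℝ}

lemma exists_perm_of_isEigenvalueList (hl : IsEigenvalueList A l) (hl' : IsEigenvalueList A l') :
    ∃ π : Equiv.Perm (Fin n), l ∘ π = l' := by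
  have hroots (f : Fin n → ℂ) : (∏ i, (Polynomial.X - Polynomial.C (f i))).roots =
      Finset.univ.val.map f := by
    rw [← Polynomial.roots_multiset_prod_X_sub_C (Finset.univ.val.map f), Multiset.map_map]
    rfl
  refine exists_perm_comp_eq_of_map_univ_eq ?_
  rw [← hroots, ← hroots, ← hl, ← hl']

lemma image_totalRate_eq_of_isEigenvalueList (hl : IsEigenvalueList A l)
    (hl' : IsEigenvalueList A l') :
    totalRate T σ l' '' allocations n P = totalRate T σ l '' allocations n P := by
  obtain ⟨π, rfl⟩ := exists_perm_of_isEigenvalueList hl hl'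
  exact image_totalRate_comp_perm l π

lemma re_neg_of_isEigenvalueList (hl : IsEigenvalueList A l) (hstable : IsStable A) (i : Fin n) :
    (l i).re < 0 := by
  refine hstable _ (mem_spectrum_of_isRoot_charpoly ?_)
  rw [hl, Polynomial.IsRoot, Polynomial.eval_prod]
  exact Finset.prod_eq_zero (Finset.mem_univ i) (by simp)

lemma isEigenvalueList_of_coords_eq_diagonal {U : unitaryGroup (Fin n) ℂ}
    (hA : coords U A = diagonal l) : IsEigenvalueList A l := by
  rw [IsEigenvalueList, ← charpoly_coords U, hA, charpoly_diagonal]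

lemma isStarNormal_toComplex (h : A * Aᵀ = Aᵀ * A) : IsStarNormal (toComplex A) := by
  have hstar : star (toComplex A) = toComplex Aᵀ := by
    ext i j
    simp [toComplex]
  refine ⟨?_⟩
  rw [hstar, commute_iff_eq, toComplex, toComplex, ← Matrix.map_mul, ← Matrix.map_mul, h]

lemma exists_coords_eq_diagonal (h : A * Aᵀ = Aᵀ * A) :
    ∃ (U : unitaryGroup (Fin n) ℂ) (d : Fin n → ℂ), coords U A = diagonal d :=
  exists_unitary_conj_eq_diagonal (isStarNormal_toComplex h)

end EigenvalueLists

section Realization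

variable {n : ℕ} {U : unitaryGroup (Fin n) ℂ} {A : Matrix (Fin n) (Fin n) ℝ} {d : Fin n → ℂ}

lemma exists_polynomial_eval_eq {ι F : Type*} [Finite ι] [Field F] {x y : ι → F}
    (h : ∀ i j, x i = x j → y i = y j) : ∃ g : Polynomial F, ∀ i, g.eval (x i) = y i := by
  classical
  have := Fintype.ofFinite ι
  obtain ⟨f, hf⟩ := (Function.factorsThrough_iff (g := y) (f := x)).mp fun i j => h i j
  refine ⟨Lagrange.interpolate (Finset.univ.image x) id f, fun i => ?_⟩
  rw [hf]
  exact Lagrange.eval_interpolate_at_node f (Set.injOn_id _)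
    (Finset.mem_image_of_mem x (Finset.mem_univ i))

lemma aeval_diagonal {ι S R : Type*} [Fintype ι] [DecidableEq ι] [CommSemiring S] [Semiring R]
    [Algebra S R] (g : Polynomial S) (v : ι → R) :
    Polynomial.aeval (diagonal v) g = diagonal fun i => Polynomial.aeval (v i) g :=
  (Polynomial.aeval_algHom_apply (diagonalAlgHom (n := ι) (α := R) S) v g).trans <|
    congrArg diagonal (Polynomial.aeval_pi_apply v g)

lemma coords_add_transpose (hA : coords U A = diagonal d) :
    coords U (A + Aᵀ) = diagonal fun i => ((2 * (d i).re : ℝ) : ℂ) := by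
  rw [map_add, coords_transpose, hA, diagonal_conjTranspose, diagonal_add]
  congr 1
  ext i
  exact Complex.add_conj (d i)

lemma exists_posSemidef_coords_eq_diagonal (hA : coords U A = diagonal d) {p : Fin n → ℝ}
    (hp : 0 ≤ p) (hpd : ∀ i j, (d i).re = (d j).re → p i = p j) :
    ∃ S : Matrix (Fin n) (Fin n) ℝ, S.PosSemidef ∧ coords U S = diagonal fun i => (p i : ℂ) := by
  obtain ⟨g, hg⟩ := exists_polynomial_eval_eq (x := fun i => 2 * (d i).re) (y := p)
    fun i j hij => hpd i j (mul_left_cancel₀ two_ne_zero hij)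
  have hcoords : coords U (Polynomial.aeval (A + Aᵀ) g) = diagonal fun i => (p i : ℂ) := by
    rw [← Polynomial.aeval_algHom_apply (coords U), coords_add_transpose hA, aeval_diagonal]
    congr 1
    ext i
    rw [← hg i]
    exact Polynomial.aeval_algebraMap_apply_eq_algebraMap_eval _ _
  refine ⟨_, posSemidef_of_posSemidef_coords (hcoords ▸ PosSemidef.diagonal fun i => ?_), hcoords⟩
  exact Complex.zero_le_real.mpr (hp i)

end Realization

section Capacity

variable {n : ℕ} {U : unitaryGroup (Fin n) ℂ} {A : Matrix (Fin n) (Fin n) ℝ} {d l : Fin n → ℂ}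
  {T σ P R : ℝ}

lemma exists_mem_admissible_info_eq (hA : coords U A = diagonal d) (hd : ∀ i, (d i).re < 0)
    (hT : 0 < T) (hσ : σ ≠ 0) (hR : IsGreatest (totalRate T σ d '' allocations n P) R) :
    ∃ S ∈ admissible n P, info (p := n) A 1 1 T σ S = T * R := by
  obtain ⟨⟨p, hp, rfl⟩, hub⟩ := hR
  have hmax : IsMaxOn (totalRate T σ d) (allocations n P) p := fun q hq => hub ⟨q, hq, rfl⟩
  obtain ⟨S, hS, hcoords⟩ := exists_posSemidef_coords_eq_diagonal hA hp.1 fun _ _ =>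
    eq_of_isMaxOn_totalRate_of_re_eq hT hσ hd hp hmax
  have hpower : modalPower U S = p := by
    ext i
    simp [modalPower, hcoords]
  refine ⟨S, ⟨hS, ?_⟩, ?_⟩
  · rw [← sum_modalPower U S, hpower, hp.2]
  · rw [info_eq_of_isDiag_coords hA hd hT hσ hS (hcoords ▸ isDiag_diagonal _), hpower]

theorem isGreatest_info (hA : coords U A = diagonal d) (hl : IsEigenvalueList A l)
    (hstable : IsStable A) (hn : 0 < n) (hT : 0 < T) (hσ : σ ≠ 0)
    (hR : IsGreatest (totalRate T σ l '' allocations n P) R) :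
    IsGreatest (info (p := n) A 1 1 T σ '' admissible n P) (T * R) := by
  have hlist := isEigenvalueList_of_coords_eq_diagonal hA
  have hd := re_neg_of_isEigenvalueList hlist hstable
  rw [image_totalRate_eq_of_isEigenvalueList hlist hl] at hR
  refine ⟨exists_mem_admissible_info_eq hA hd hT hσ hR, ?_⟩
  rintro _ ⟨S, hS, rfl⟩
  have hbound : T * totalRate T σ d (modalPower U S) ≤ T * R :=
    mul_le_mul_of_nonneg_left (totalRate_modalPower_le hn hd hT hσ hS hR.2) hT.le
  by_cases hdiag : (coords U S).IsDiag
  · exact (info_eq_of_isDiag_coords hA hd hT hσ hS.1 hdiag).trans_le hbound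
  · exact (info_lt_of_not_isDiag_coords hA hd hT hσ hS.1 hdiag).le.trans hbound

theorem isDiag_coords_of_isMaxOn_info (hA : coords U A = diagonal d) (hl : IsEigenvalueList A l)
    (hstable : IsStable A) (hn : 0 < n) (hT : 0 < T) (hσ : σ ≠ 0)
    (hR : IsGreatest (totalRate T σ l '' allocations n P) R) {S : Matrix (Fin n) (Fin n) ℝ}
    (hS : S ∈ admissible n P) (hmax : IsMaxOn (info (p := n) A 1 1 T σ) (admissible n P) S) :
    (coords U S).IsDiag := by
  by_contra hoff
  have hlist := isEigenvalueList_of_coords_eq_diagonal hA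
  have hd := re_neg_of_isEigenvalueList hlist hstable
  rw [image_totalRate_eq_of_isEigenvalueList hlist hl] at hR
  obtain ⟨S', hS', hinfo⟩ := exists_mem_admissible_info_eq hA hd hT hσ hR
  have hattained : T * R ≤ info (p := n) A 1 1 T σ S := hinfo ▸ hmax hS'
  have hstrict := info_lt_of_not_isDiag_coords hA hd hT hσ hS.1 hoff
  have hbound : T * totalRate T σ d (modalPower U S) ≤ T * R :=
    mul_le_mul_of_nonneg_left (totalRate_modalPower_le hn hd hT hσ hS hR.2) hT.le
  exact (hattained.trans_lt (hstrict.trans_le hbound)).false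

end Capacity

end InfoRate

end

theorem mainTheorem3 (n : ℕ) (hn : 0 < n) (A B C : Matrix (Fin n) (Fin n) ℝ)
    (hB : B = 1) (hC : C = 1)
    (hnormal : A * A.transpose = A.transpose * A) (hstable : InfoRate.IsStable A)
    (l : Fin n → ℂ) (hl : InfoRate.IsEigenvalueList A l)
    (T σ P : ℝ) (hT : 0 < T) (hσ : 0 < σ) (hP : 0 ≤ P) :
    -- the maximum that defines the capacity is attained
    IsGreatest (InfoRate.info A B C T σ '' InfoRate.admissible n P)
      (InfoRate.capacity A B C T σ P) ∧
    -- every optimal covariance is diagonal in every orthonormal eigenbasis of `A`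
    (∀ S ∈ InfoRate.admissible n P,
      IsMaxOn (InfoRate.info A B C T σ) (InfoRate.admissible n P) S →
      ∀ U ∈ Matrix.unitaryGroup (Fin n) ℂ,
        (U * InfoRate.toComplex A * U.conjTranspose).IsDiag →
        (U * InfoRate.toComplex S * U.conjTranspose).IsDiag) ∧
    -- the rate is the maximum over the power allocations of the sum of the scalar rates
    IsGreatest ((fun p : Fin n → ℝ => ∑ i, InfoRate.scalarRate T σ (p i) (l i)) ''
        InfoRate.allocations n P)
      (InfoRate.rate A B C T σ P) := by
  subst hB hC
  have hre := InfoRate.re_neg_of_isEigenvalueList hl hstable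
  obtain ⟨R, hR⟩ := InfoRate.exists_isGreatest_totalRate hn hT.ne' hσ.ne' hP hre
  obtain ⟨U, d, hU⟩ := InfoRate.exists_coords_eq_diagonal hnormal
  have hgreatest := InfoRate.isGreatest_info hU hl hstable hn hT hσ.ne' hR
  have hcapacity : InfoRate.capacity (p := n) A 1 1 T σ P = T * R := hgreatest.csSup_eq
  refine ⟨hcapacity ▸ hgreatest, fun S hS hmax V hV hVA => ?_, ?_⟩
  · have hV' : InfoRate.coords ⟨V, hV⟩ A = Matrix.diagonal _ := hVA.diagonal_diag.symm
    exact InfoRate.isDiag_coords_of_isMaxOn_info hV' hl hstable hn hT hσ.ne' hR hS hmax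
  · rwa [InfoRate.rate, hcapacity, mul_div_cancel_left₀ R hT.ne']
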